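/- Let $p>q$ be primes with $p\equiv 1 \pmod q$, and let $g\in\mathbb Z$ have multiplicative order $q$ modulo $p$. Let $C=C_{pq}$ be the cyclic group of order $pq$ and let $M=M_{pq}=\langle \sigma,\tau \mid \sigma^p=\tau^q=1,\ \tau\sigma\tau^{-1}=\sigma^g\rangle$. Let $G\cong C_{pq}$ be generated by commuting elements $\sigma$ of order $p$ and $\tau$ of order $q$. Let $\lambda:G\to\mathrm{Perm}(G)$ be the left regular representation. A subgroup $N\le \mathrm{Perm}(G)$ is *regular* if it acts simply transitively on $G$, and *$G$-stable* if $\lambda(x)N\lambda(x)^{-1}\subseteq N$ for all $x\in G$. A *skew brace* $(B,\cdot,\circ)$ is a set with two group structures (the dot group and the circle group) such that $x\circ(y\cdot z)=(x\circ y)\cdot x^{-1}\cdot(x\circ z)$ for all $x,y,z$, where $x^{-1}$ is the inverse in the dot group. A regular $G$-stable subgroup $N$ yields the skew brace $(N,\cdot,\circ)$, where $\cdot$ is the operation of $N$ and $\eta\circ\pi=a^{-1}(a(\eta)a(\pi))$, with $a:N\to G$ the bijection $a(\eta)=\eta[1_G]$. Two regular $G$-stable subgroups are *brace equivalent* if they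 yield isomorphic skew braces. For $1\le t\le q-1$ let $N_t=\langle \lambda(\sigma),\pi_t\rangle$, where $\pi_t(\sigma^u\tau^v)=\sigma^{ug^t}\tau^{v-1}$, and let $N_t'$ be the centralizer of $N_t$ in $\mathrm{Perm}(G)$. All $N_t$ and $N_t'$ are regular $G$-stable subgroups of $\mathrm{Perm}(G)$ isomorphic to $M$, and $N_t'=\langle \eta_t,\lambda(\tau)\rangle$, where $\eta_t(\sigma^u\tau^v)=\sigma^{u+g^{-tv}}\tau^v$ (the power $g^{-tv}$ being taken modulo $p$). Moreover: 1. for all $1\le s,t\le q-1$, the subgroups $N_s$ and $N_t$ are brace equivalent, the subgroups $N_s'$ and $N_t'$ are brace equivalent, and $N_s$ and $N_t'$ are not brace equivalent; 2. there are exactly two isomorphism classes of skew braces $(B,\cdot,\circ)$ with $(B,\cdot)\cong M_{pq}$ and $(B,\circ)\cong C_{pq}$. -/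

import Mathlib

universe u v w

/-! ### Skew left braces -/

/-- A skew left brace structure on `B`: two group structures, the dot group and the circle
group, satisfying `x ∘ (y · z) = (x ∘ y) · x⁻¹ · (x ∘ z)`. -/
structure SkewBrace (B : Type u) where
  dot : Group B
  circ : Group B
  brace_rel : ∀ x y z : B, circ.mul x (dot.mul y z) =
    dot.mul (dot.mul (circ.mul x y) (dot.inv x)) (circ.mul x z)

namespace SkewBrace

/-- The dot group `(B, ·)`. -/
def Dot {B : Type u} (_ : SkewBrace B) : Type u := B

/-- The circle group `(B, ∘)`. -/
def Circ {B : Type u} (_ : SkewBrace B) : Type u := B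

instance {B : Type u} (b : SkewBrace B) : Group b.Dot := b.dot

instance {B : Type u} (b : SkewBrace B) : Group b.Circ := b.circ

/-- Two skew left braces are isomorphic if there is a bijection between them that respects
both operations. -/
def Isomorphic {B : Type u} {C : Type v} (b : SkewBrace B) (c : SkewBrace C) : Prop :=
  ∃ e : B ≃ C, (∀ x y, e (b.dot.mul x y) = c.dot.mul (e x) (e y)) ∧
    (∀ x y, e (b.circ.mul x y) = c.circ.mul (e x) (e y))

end SkewBrace

/-- A skew left brace in the universe `u`, bundled with its underlying set. -/
structure BundledBrace : Type (u + 1) where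
  carrier : Type u
  str : SkewBrace carrier

/-- Isomorphism of skew left braces, as an equivalence relation. -/
def braceSetoid : Setoid BundledBrace.{u} where
  r b c := b.str.Isomorphic c.str
  iseqv :=
    { refl := fun _ => ⟨Equiv.refl _, fun _ _ => rfl, fun _ _ => rfl⟩
      symm := by
        rintro b c ⟨e, h1, h2⟩
        refine ⟨e.symm, fun x y => ?_, fun x y => ?_⟩
        · rw [Equiv.symm_apply_eq, h1, e.apply_symm_apply, e.apply_symm_apply]
        · rw [Equiv.symm_apply_eq, h2, e.apply_symm_apply, e.apply_symm_apply]
      trans := by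
        rintro b c d ⟨e, h1, h2⟩ ⟨f, k1, k2⟩
        refine ⟨e.trans f, fun x y => ?_, fun x y => ?_⟩
        · simp only [Equiv.trans_apply, h1, k1]
        · simp only [Equiv.trans_apply, h2, k2] }

/-- The isomorphism classes of the skew left braces whose dot group is isomorphic to `M`
and whose circle group is isomorphic to `C`. -/
def braceClasses (M : Type v) (C : Type w) [Group M] [Group C] :
    Set (Quotient braceSetoid.{u}) :=
  {c | ∃ b : BundledBrace.{u}, Nonempty (b.str.Dot ≃* M) ∧ Nonempty (b.str.Circ ≃* C) ∧
    Quotient.mk braceSetoid b = c}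

/-! ### Regular `G`-stable subgroups of `Perm(G)` and brace equivalence -/

section RegularStable

variable {G : Type u} [Group G]

/-- The left regular representation `λ : G → Perm(G)`, `λ(x)[y] = x * y`. -/
def leftReg (x : G) : Equiv.Perm G := Equiv.mulLeft x

/-- `N` is a regular subgroup of `Perm(G)` (simply transitive on `G`) that is stable under the
action `η ↦ λ(x) η λ(x)⁻¹` of `G`. -/
structure IsRegularStable (N : Subgroup (Equiv.Perm G)) : Prop where
  regular : ∀ x y : G, ∃! η : N, (η : Equiv.Perm G) x = y
  stable : ∀ x : G, ∀ η ∈ N, leftReg x * η * (leftReg x)⁻¹ ∈ N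

/-- The bijection `a : N → G`, `a(η) = η[1]`. -/
noncomputable def IsRegularStable.a {N : Subgroup (Equiv.Perm G)} (h : IsRegularStable N) :
    N ≃ G :=
  Equiv.ofBijective (fun η : N => (η : Equiv.Perm G) 1)
    ((Function.bijective_iff_existsUnique _).2 fun y => h.regular 1 y)

theorem IsRegularStable.a_apply {N : Subgroup (Equiv.Perm G)} (h : IsRegularStable N) (η : N) :
    h.a η = (η : Equiv.Perm G) 1 := rfl

theorem IsRegularStable.circ_eq {N : Subgroup (Equiv.Perm G)} (h : IsRegularStable N)
    (η π : N) : h.a.symm (h.a η * h.a π) =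
      ⟨leftReg (h.a η) * π * (leftReg (h.a η))⁻¹, h.stable _ _ π.2⟩ * η := by
  rw [Equiv.symm_apply_eq, h.a_apply (_ * η)]
  simp only [Subgroup.coe_mul, Equiv.Perm.mul_apply, ← h.a_apply η]
  simp [leftReg, Equiv.Perm.inv_def, h.a_apply π]

/-- The skew left brace `(N, ·, ∘)` given by `N`: the dot operation is that of `N`, and
`η ∘ π = a⁻¹(a(η) a(π))`. -/
noncomputable def IsRegularStable.brace {N : Subgroup (Equiv.Perm G)} (h : IsRegularStable N) :
    SkewBrace N where
  dot := inferInstance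
  circ := h.a.group
  brace_rel := by
    intro x y z
    change h.a.symm (h.a x * h.a (y * z)) =
      h.a.symm (h.a x * h.a y) * x⁻¹ * h.a.symm (h.a x * h.a z)
    rw [h.circ_eq, h.circ_eq, h.circ_eq]
    apply Subtype.ext
    simp [mul_assoc]

/-- Two regular `G`-stable subgroups of `Perm(G)` are brace equivalent if they yield isomorphic
skew left braces. -/
def BraceEquivalent (N N' : Subgroup (Equiv.Perm G)) : Prop :=
  ∃ (h : IsRegularStable N) (h' : IsRegularStable N'), h.brace.Isomorphic h'.brace

/-- The opposite subgroup of `N`: its centralizer in `Perm(G)`. -/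
def oppositeSubgroup (N : Subgroup (Equiv.Perm G)) : Subgroup (Equiv.Perm G) :=
  Subgroup.centralizer (N : Set (Equiv.Perm G))

end RegularStable

/-! ### The groups of order `pq` -/

/-- The metacyclic group `M = ⟨σ, τ | σ ^ p = τ ^ q = 1, τ σ τ⁻¹ = σ ^ g⟩`. -/
abbrev MetacyclicGroup (p q : ℕ) (g : ℤ) : Type :=
  PresentedGroup
    ({FreeGroup.of 0 ^ p, FreeGroup.of 1 ^ q,
      FreeGroup.of 1 * FreeGroup.of 0 * (FreeGroup.of 1)⁻¹ * (FreeGroup.of 0 ^ g)⁻¹} :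
      Set (FreeGroup (Fin 2)))

/-- `G` is generated by commuting elements `σ` of order `p` and `τ` of order `q`. For distinct
primes `p` and `q` this says that `G` is cyclic of order `pq`, described by two generators. -/
structure IsCyclicPQ {G : Type u} [Group G] (p q : ℕ) (σ τ : G) : Prop where
  orderOf_left : orderOf σ = p
  orderOf_right : orderOf τ = q
  rel : τ * σ * τ⁻¹ = σ
  generate : Subgroup.closure {σ, τ} = ⊤

section Families

variable {G : Type u} [Group G] {p q : ℕ} {σ τ : G} {g : ℤ}

theorem IsCyclicPQ.commute (h : IsCyclicPQ p q σ τ) : Commute σ τ := by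
  have := h.rel
  rw [mul_inv_eq_iff_eq_mul] at this
  exact this.symm

theorem IsCyclicPQ.bijective [Fact p.Prime] [Fact q.Prime] (hqp : q < p)
    (h : IsCyclicPQ p q σ τ) :
    Function.Bijective (fun x : ZMod p × ZMod q => σ ^ x.1.val * τ ^ x.2.val) := by
  have hp : p.Prime := Fact.out
  have hq : q.Prime := Fact.out
  have hco : Nat.Coprime p q := (Nat.coprime_primes hp hq).2 hqp.ne'
  have hc := h.commute
  have hord : orderOf (σ * τ) = p * q := by
    rw [hc.orderOf_mul_eq_mul_orderOf_of_coprime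
      (by rw [h.orderOf_left, h.orderOf_right]; exact hco), h.orderOf_left, h.orderOf_right]
  have hσ : ∀ n : ℕ, σ ^ (n : ZMod p).val = σ ^ n := fun n => by
    rw [ZMod.val_natCast, ← h.orderOf_left, pow_mod_orderOf]
  have hτ : ∀ n : ℕ, τ ^ (n : ZMod q).val = τ ^ n := fun n => by
    rw [ZMod.val_natCast, ← h.orderOf_right, pow_mod_orderOf]
  constructor
  · rintro ⟨a, b⟩ ⟨c, d⟩ hx
    change σ ^ a.val * τ ^ b.val = σ ^ c.val * τ ^ d.val at hx
    have h1 := congrArg (fun y => y ^ q) hx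
    have h2 := congrArg (fun y => y ^ p) hx
    simp only [(hc.pow_pow _ _).mul_pow, ← pow_mul] at h1 h2
    rw [pow_eq_one_iff_modEq.2 (show b.val * q ≡ 0 [MOD orderOf τ] by
      rw [h.orderOf_right]; exact Nat.modEq_zero_iff_dvd.2 (dvd_mul_left _ _)),
      pow_eq_one_iff_modEq.2 (show d.val * q ≡ 0 [MOD orderOf τ] by
      rw [h.orderOf_right]; exact Nat.modEq_zero_iff_dvd.2 (dvd_mul_left _ _)),
      mul_one, mul_one, pow_eq_pow_iff_modEq, h.orderOf_left] at h1
    rw [pow_eq_one_iff_modEq.2 (show a.val * p ≡ 0 [MOD orderOf σ] by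
      rw [h.orderOf_left]; exact Nat.modEq_zero_iff_dvd.2 (dvd_mul_left _ _)),
      pow_eq_one_iff_modEq.2 (show c.val * p ≡ 0 [MOD orderOf σ] by
      rw [h.orderOf_left]; exact Nat.modEq_zero_iff_dvd.2 (dvd_mul_left _ _)),
      one_mul, one_mul, pow_eq_pow_iff_modEq, h.orderOf_right] at h2
    have h1' := Nat.ModEq.cancel_right_of_coprime hco h1
    have h2' := Nat.ModEq.cancel_right_of_coprime hco.symm h2
    rw [← ZMod.natCast_eq_natCast_iff, ZMod.natCast_zmod_val, ZMod.natCast_zmod_val] at h1' h2'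
    rw [h1', h2']
  · intro x
    have hx : x ∈ Subgroup.closure {σ, τ} := h.generate ▸ Subgroup.mem_top x
    induction hx using Subgroup.closure_induction with
    | mem y hy =>
      rcases hy with rfl | rfl
      · exact ⟨((1 : ℕ), (0 : ℕ)), by simp only [hσ, hτ]; simp⟩
      · exact ⟨((0 : ℕ), (1 : ℕ)), by simp only [hσ, hτ]; simp⟩
    | one => exact ⟨((0 : ℕ), (0 : ℕ)), by simp only [hσ, hτ]; simp⟩
    | mul y z _ _ hy hz =>
      obtain ⟨⟨a, b⟩, rfl⟩ := hy
      obtain ⟨⟨c, d⟩, rfl⟩ := hz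
      refine ⟨((a.val + c.val : ℕ), (b.val + d.val : ℕ)), ?_⟩
      simp only [hσ, hτ, pow_add]
      rw [mul_assoc, mul_assoc, ← mul_assoc (σ ^ c.val), (hc.pow_pow c.val b.val).eq]
      simp only [mul_assoc]
    | inv y _ hy =>
      obtain ⟨⟨a, b⟩, rfl⟩ := hy
      refine ⟨((p - a.val : ℕ), (q - b.val : ℕ)), ?_⟩
      simp only [hσ, hτ]
      rw [eq_comm, inv_eq_iff_mul_eq_one, mul_assoc, ← mul_assoc (τ ^ b.val),
        ← (hc.pow_pow (p - a.val) b.val).eq, mul_assoc, ← pow_add, ← mul_assoc, ← pow_add,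
        Nat.add_sub_cancel' (ZMod.val_lt a).le, Nat.add_sub_cancel' (ZMod.val_lt b).le,
        ← h.orderOf_left, ← h.orderOf_right, pow_orderOf_eq_one, pow_orderOf_eq_one, one_mul]

/-- The bijection `(u, v) ↦ σ ^ u * τ ^ v` from `ZMod p × ZMod q` to `G`. -/
noncomputable def IsCyclicPQ.coord [Fact p.Prime] [Fact q.Prime] (hqp : q < p)
    (h : IsCyclicPQ p q σ τ) : ZMod p × ZMod q ≃ G :=
  Equiv.ofBijective _ (h.bijective hqp)

theorem IsCyclicPQ.coord_intCast [Fact p.Prime] [Fact q.Prime] (hqp : q < p)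
    (h : IsCyclicPQ p q σ τ) (u v : ℤ) :
    h.coord hqp ((u : ZMod p), (v : ZMod q)) = σ ^ u * τ ^ v := by
  change σ ^ (u : ZMod p).val * τ ^ (v : ZMod q).val = _
  rw [← zpow_natCast, ← zpow_natCast, ZMod.val_intCast, ZMod.val_intCast,
    ← zpow_mod_orderOf σ u, ← zpow_mod_orderOf τ v, h.orderOf_left, h.orderOf_right]

theorem ne_zero_of_orderOf_eq_prime [Fact p.Prime] [Fact q.Prime]
    (hg : orderOf (g : ZMod p) = q) : (g : ZMod p) ≠ 0 := by
  intro h0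
  have := pow_orderOf_eq_one (g : ZMod p)
  rw [hg, h0, zero_pow (Fact.out : q.Prime).ne_zero] at this
  exact zero_ne_one this

/-- The permutation `π_t` of `G`, `π_t(σ ^ u τ ^ v) = σ ^ (u g ^ t) τ ^ (v - 1)`. -/
noncomputable def piPerm [Fact p.Prime] [Fact q.Prime] (hqp : q < p)
    (hG : IsCyclicPQ p q σ τ) (hg : orderOf (g : ZMod p) = q) (t : ℕ) : Equiv.Perm G :=
  (hG.coord hqp).permCongr
    (Equiv.prodCongr
      (Equiv.mulRight₀ ((g : ZMod p) ^ t) (pow_ne_zero t (ne_zero_of_orderOf_eq_prime hg)))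
      (Equiv.subRight (1 : ZMod q)))

/-- The permutation `η_t` of `G`, `η_t(σ ^ u τ ^ v) = σ ^ (u + g ^ (-t v)) τ ^ v`, where the
power `g ^ (-t v)` is taken modulo `p`. -/
noncomputable def etaPerm [Fact p.Prime] [Fact q.Prime] (hqp : q < p)
    (hG : IsCyclicPQ p q σ τ) (g : ℤ) (t : ℕ) : Equiv.Perm G :=
  (hG.coord hqp).permCongr
    { toFun := fun x => (x.1 + (g : ZMod p) ^ (-((t : ℤ) * (x.2.val : ℤ))), x.2)
      invFun := fun x => (x.1 - (g : ZMod p) ^ (-((t : ℤ) * (x.2.val : ℤ))), x.2)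
      left_inv := fun x => by simp
      right_inv := fun x => by simp }

theorem piPerm_apply [Fact p.Prime] [Fact q.Prime] (hqp : q < p)
    (hG : IsCyclicPQ p q σ τ) (hg : orderOf (g : ZMod p) = q) (t : ℕ) (u v : ℤ) :
    piPerm hqp hG hg t (σ ^ u * τ ^ v) = σ ^ (u * g ^ t) * τ ^ (v - 1) := by
  rw [← hG.coord_intCast hqp, ← hG.coord_intCast hqp]
  simp [piPerm, Equiv.permCongr_apply]

theorem etaPerm_apply [Fact p.Prime] [Fact q.Prime] (hqp : q < p)
    (hG : IsCyclicPQ p q σ τ) (hg : orderOf (g : ZMod p) = q) (t : ℕ) (u v c : ℤ)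
    (hc : (c : ZMod p) = (g : ZMod p) ^ (-((t : ℤ) * v))) :
    etaPerm hqp hG g t (σ ^ u * τ ^ v) = σ ^ (u + c) * τ ^ v := by
  have h0 := ne_zero_of_orderOf_eq_prime hg
  have key : (g : ZMod p) ^ (-((t : ℤ) * ((v : ZMod q).val : ℤ))) = (c : ZMod p) := by
    rw [hc, ZMod.val_intCast]
    have h1 : (g : ZMod p) ^ (q : ℤ) = 1 := by
      rw [zpow_natCast, ← hg, pow_orderOf_eq_one]
    conv_rhs => rw [← Int.emod_add_mul_ediv v q]
    rw [show -((t : ℤ) * (v % q + q * (v / q))) = -(t * (v % q)) + q * (-(t * (v / q))) by ring,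
      zpow_add₀ h0, zpow_mul _ (q : ℤ), h1, one_zpow, mul_one]
  rw [← hG.coord_intCast hqp, ← hG.coord_intCast hqp]
  simp only [etaPerm, Equiv.permCongr_apply, Equiv.symm_apply_apply, Equiv.coe_fn_mk, key]
  push_cast
  rfl

/-- The subgroup `N_t = ⟨λ(σ), π_t⟩` of `Perm(G)`. -/
noncomputable def familyN [Fact p.Prime] [Fact q.Prime] (hqp : q < p)
    (hG : IsCyclicPQ p q σ τ) (hg : orderOf (g : ZMod p) = q) (t : ℕ) :
    Subgroup (Equiv.Perm G) :=
  Subgroup.closure {leftReg σ, piPerm hqp hG hg t}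

/-- The subgroup `N_t'`, the opposite of `N_t`. -/
noncomputable def familyN' [Fact p.Prime] [Fact q.Prime] (hqp : q < p)
    (hG : IsCyclicPQ p q σ τ) (hg : orderOf (g : ZMod p) = q) (t : ℕ) :
    Subgroup (Equiv.Perm G) :=
  oppositeSubgroup (familyN hqp hG hg t)

end Families

/-!
The dot group of a skew brace acts on the brace by left translations. Carried to `G` along an
isomorphism of the circle group with `G`, these translations form a regular `G`-stable subgroup
whose skew brace is the given one, and whose centralizer comes in the same way from the opposite
skew brace. In the coordinates `σ ^ u * τ ^ v` the subgroup `N_t` comes from the brace on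
`ZMod p × ZMod q` whose circle group is the direct product and whose dot group is the semidirect
product in which `v` acts as `χ v ^ (-t)`, with `χ v = g ^ v`. Rescaling `ZMod q` by `-t` removes
`t`, so up to isomorphism only the brace of `χ` and its opposite occur.

That no other skew brace has these two groups is seen from the maps `λ_x`. They are automorphisms
of the semidirect product, hence of the form `(a, v) ↦ (r a + s (χ v - 1), v)`, and they commute
when the circle group is commutative. So either they all fix a common complement of `ZMod p`, and
the brace is that of `χ`, or they are all inner, and it is the opposite one.
-/

namespace SkewBrace

section Isomorphic

variable {B : Type u} {C : Type v} {D : Type w} {b : SkewBrace B} {c : SkewBrace C}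
  {d : SkewBrace D}

theorem Isomorphic.symm (h : b.Isomorphic c) : c.Isomorphic b := by
  obtain ⟨e, hdot, hcirc⟩ := h
  refine ⟨e.symm, fun x y => ?_, fun x y => ?_⟩
  · rw [Equiv.symm_apply_eq, hdot, e.apply_symm_apply, e.apply_symm_apply]
  · rw [Equiv.symm_apply_eq, hcirc, e.apply_symm_apply, e.apply_symm_apply]

theorem Isomorphic.trans (h : b.Isomorphic c) (k : c.Isomorphic d) : b.Isomorphic d := by
  obtain ⟨e, edot, ecirc⟩ := h
  obtain ⟨f, fdot, fcirc⟩ := k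
  exact ⟨e.trans f, fun x y => by simp only [Equiv.trans_apply, edot, fdot],
    fun x y => by simp only [Equiv.trans_apply, ecirc, fcirc]⟩

theorem Isomorphic.nonempty_dot (h : b.Isomorphic c) : Nonempty (b.Dot ≃* c.Dot) := by
  obtain ⟨e, hdot, -⟩ := h
  exact ⟨⟨e, hdot⟩⟩

theorem Isomorphic.nonempty_circ (h : b.Isomorphic c) : Nonempty (b.Circ ≃* c.Circ) := by
  obtain ⟨e, -, hcirc⟩ := h
  exact ⟨⟨e, hcirc⟩⟩

end Isomorphic

section Opposite

variable {B : Type u} {C : Type v} (b : SkewBrace B) {c : SkewBrace C}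

/-- The opposite skew left brace, whose dot operation is reversed and whose circle operation is
unchanged. -/
def op : SkewBrace B where
  dot := letI := b.dot; MulOpposite.opEquiv.group
  circ := b.circ
  brace_rel x y z := by
    let := b.dot
    exact (b.brace_rel x z y).trans (mul_assoc (b.circ.mul x z) x⁻¹ (b.circ.mul x y))

theorem op_dot_mul (x y : B) : b.op.dot.mul x y = b.dot.mul y x := rfl

theorem op_circ_mul (x y : B) : b.op.circ.mul x y = b.circ.mul x y := rfl

/-- Inversion, as an isomorphism from the dot group of the opposite brace to the dot group. -/
def opDotEquiv : b.op.Dot ≃* b.Dot where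
  toEquiv := Equiv.inv b.Dot
  map_mul' x y := mul_inv_rev (G := b.Dot) y x

variable {b}

theorem Isomorphic.op (h : b.Isomorphic c) : b.op.Isomorphic c.op := by
  obtain ⟨e, hdot, hcirc⟩ := h
  exact ⟨e, fun x y => hdot y x, hcirc⟩

theorem isomorphic_op_of_dot_inv (e : B ≃ C)
    (hdot : ∀ x y, e (b.dot.mul x y) = c.dot.mul (e x) (e y))
    (hcirc : ∀ x y, c.dot.inv (e (b.circ.mul x y)) =
      c.circ.mul (c.dot.inv (e x)) (c.dot.inv (e y))) :
    b.Isomorphic c.op :=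
  ⟨e.trans (Equiv.inv c.Dot),
    fun x y => (congrArg c.dot.inv (hdot x y)).trans (mul_inv_rev (G := c.Dot) (e x) (e y)),
    hcirc⟩

theorem closure_op_dot_eq_top {s : Set b.Dot} (hs : Subgroup.closure s = ⊤) :
    Subgroup.closure (G := b.op.Dot) s = ⊤ := by
  have himage : b.opDotEquiv.toMonoidHom '' s = s⁻¹ := Set.image_inv_eq_inv
  apply Subgroup.map_injective (f := b.opDotEquiv.toMonoidHom) b.opDotEquiv.injective
  calc (Subgroup.closure (G := b.op.Dot) s).map b.opDotEquiv.toMonoidHom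
    _ = Subgroup.closure s⁻¹ := (MonoidHom.map_closure _ _).trans (congrArg _ himage)
    _ = ⊤ := (Subgroup.closure_inv s).trans hs
    _ = Subgroup.map b.opDotEquiv.toMonoidHom ⊤ :=
      (Subgroup.map_top_of_surjective _ b.opDotEquiv.surjective).symm

end Opposite

section Transport

variable {B : Type u} {C : Type v}

/-- The transport of a skew left brace along a bijection. -/
def transport (e : C ≃ B) (b : SkewBrace B) : SkewBrace C where
  dot := letI := b.dot; e.group
  circ := letI := b.circ; e.group
  brace_rel x y z := by
    change e.symm (b.circ.mul (e x) (e (e.symm (b.dot.mul (e y) (e z))))) =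
      e.symm (b.dot.mul (e (e.symm (b.dot.mul (e (e.symm (b.circ.mul (e x) (e y))))
        (e (e.symm (b.dot.inv (e x))))))) (e (e.symm (b.circ.mul (e x) (e z)))))
    simp only [e.apply_symm_apply, b.brace_rel]

theorem transport_isomorphic (e : C ≃ B) (b : SkewBrace B) : (b.transport e).Isomorphic b :=
  ⟨e, fun _ _ => e.apply_symm_apply _, fun _ _ => e.apply_symm_apply _⟩

end Transport

section IsoClass

variable {B C : Type u}

/-- The isomorphism class of a skew left brace on a type of the universe `u`, among the bundled
skew left braces of a possibly larger universe. -/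
def isoClass (b : SkewBrace B) : Quotient braceSetoid.{max u v} :=
  Quotient.mk braceSetoid ⟨ULift.{v} B, b.transport Equiv.ulift⟩

theorem mk_eq_isoClass_iff {D : Type max u v} {d : SkewBrace D} {b : SkewBrace B} :
    Quotient.mk braceSetoid ⟨D, d⟩ = isoClass.{u, v} b ↔ d.Isomorphic b :=
  ⟨fun h => Isomorphic.trans (Quotient.exact h) (b.transport_isomorphic _),
    fun h => Quotient.sound (h.trans (b.transport_isomorphic _).symm)⟩

theorem isoClass_eq_isoClass_iff {b : SkewBrace B} {c : SkewBrace C} :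
    isoClass.{u, v} b = isoClass.{u, v} c ↔ b.Isomorphic c :=
  mk_eq_isoClass_iff.trans
    ⟨(b.transport_isomorphic _).symm.trans, (b.transport_isomorphic _).trans⟩

theorem isoClass_mem_braceClasses {M : Type*} {K : Type*} [Group M] [Group K]
    {b : SkewBrace B} (f : b.Dot ≃* M) (k : b.Circ ≃* K) :
    isoClass.{u, v} b ∈ braceClasses.{max u v} M K :=
  have h := b.transport_isomorphic Equiv.ulift.{v}
  ⟨_, ⟨h.nonempty_dot.some.trans f⟩, ⟨h.nonempty_circ.some.trans k⟩, rfl⟩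

end IsoClass

section Lambda

variable {B : Type u} (b : SkewBrace B)

/-- The map `λ_x(y) = x⁻¹ · (x ∘ y)`, which makes the circle group act on the dot group by
automorphisms. -/
def lam (x y : B) : B := b.dot.mul (b.dot.inv x) (b.circ.mul x y)

theorem dot_mul_lam (x y : B) : b.dot.mul x (b.lam x y) = b.circ.mul x y :=
  mul_inv_cancel_left (G := b.Dot) x (b.circ.mul x y)

theorem lam_dot_mul (x y z : B) :
    b.lam x (b.dot.mul y z) = b.dot.mul (b.lam x y) (b.lam x z) := by
  rw [lam, b.brace_rel]
  let := b.dot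
  change x⁻¹ * (b.circ.mul x y * x⁻¹ * b.circ.mul x z) =
    x⁻¹ * b.circ.mul x y * (x⁻¹ * b.circ.mul x z)
  simp only [mul_assoc]

theorem lam_injective (x : B) : Function.Injective (b.lam x) := by
  intro y z h
  have hcirc : b.circ.mul x y = b.circ.mul x z := by rw [← dot_mul_lam, h, dot_mul_lam]
  exact mul_left_cancel (G := b.Circ) (a := x) hcirc

theorem lam_circ_mul (x y z : B) : b.lam (b.circ.mul x y) z = b.lam x (b.lam y z) := by
  apply mul_left_cancel (G := b.Dot) (a := b.circ.mul x y)
  calc b.dot.mul (b.circ.mul x y) (b.lam (b.circ.mul x y) z)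
    _ = b.circ.mul (b.circ.mul x y) z := b.dot_mul_lam _ _
    _ = b.circ.mul x (b.circ.mul y z) := mul_assoc (G := b.Circ) x y z
    _ = b.dot.mul x (b.dot.mul (b.lam x y) (b.lam x (b.lam y z))) := by
      rw [← lam_dot_mul, dot_mul_lam, dot_mul_lam]
    _ = b.dot.mul (b.dot.mul x (b.lam x y)) (b.lam x (b.lam y z)) :=
      (mul_assoc (G := b.Dot) _ _ _).symm
    _ = b.dot.mul (b.circ.mul x y) (b.lam x (b.lam y z)) := by rw [dot_mul_lam]

theorem circ_one : b.circ.one = b.dot.one := by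
  have hlam : b.lam b.circ.one b.dot.one = b.dot.one :=
    map_one (MonoidHom.mk' (M := b.Dot) (G := b.Dot) (b.lam b.circ.one) (b.lam_dot_mul _))
  calc b.circ.one
    _ = b.dot.mul b.circ.one (b.lam b.circ.one b.dot.one) := by
      rw [hlam]; exact (mul_one (M := b.Dot) _).symm
    _ = b.circ.mul b.circ.one b.dot.one := b.dot_mul_lam _ _
    _ = b.dot.one := one_mul (M := b.Circ) _

end Lambda

/-! ### Regular subgroups attached to a skew brace -/

section RegularSubgroup

variable {B : Type u} {G : Type v} (b : SkewBrace B) (a : B ≃ G)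

/-- The left regular representation of the dot group, carried along the bijection `a` to a
representation by permutations of `G`. -/
def permHom : b.Dot →* Equiv.Perm G :=
  (Equiv.permCongrHom (show b.Dot ≃ G from a)).toMonoidHom.comp
    (MulAction.toPermHom b.Dot b.Dot)

theorem permHom_apply (x y : B) : b.permHom a x (a y) = a (b.dot.mul x y) :=
  congrArg (fun z => a (b.dot.mul x z)) (a.symm_apply_apply y)

theorem permHom_eq_iff {x : B} {η : Equiv.Perm G} :
    b.permHom a x = η ↔ ∀ y, a (b.dot.mul x y) = η (a y) := by
  simp only [Equiv.ext_iff, ← a.forall_congr_right (q := fun z => b.permHom a x z = η z),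
    permHom_apply]

theorem permHom_injective : Function.Injective (b.permHom a) := by
  intro x y h
  have hmul : a (b.dot.mul x x) = a (b.dot.mul y x) :=
    ((b.permHom_eq_iff a).1 h x).trans (b.permHom_apply a y x)
  exact mul_right_cancel (a.injective hmul)

/-- The regular subgroup of `Perm(G)` obtained from the left regular representation of the dot
group. -/
def permSubgroup : Subgroup (Equiv.Perm G) := (b.permHom a).range

theorem permHom_mem_permSubgroup (x : B) : b.permHom a x ∈ b.permSubgroup a := ⟨x, rfl⟩

/-- The dot group is isomorphic to its image in `Perm(G)`. -/
noncomputable def permEquiv : b.Dot ≃* b.permSubgroup a :=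
  MonoidHom.ofInjective (b.permHom_injective a)

theorem closure_permHom_pair {x y : b.Dot} (h : Subgroup.closure {x, y} = ⊤) :
    Subgroup.closure {b.permHom a x, b.permHom a y} = b.permSubgroup a := by
  rw [permSubgroup, MonoidHom.range_eq_map, ← h, MonoidHom.map_closure, Set.image_pair]

theorem commute_permHom_op_permHom (x y : B) : Commute (b.permHom a x) (b.op.permHom a y) := by
  ext z
  obtain ⟨z, rfl⟩ := a.surjective z
  simp only [Equiv.Perm.mul_apply, permHom_apply, op_dot_mul]
  exact congrArg a (mul_assoc (G := b.Dot) x z y).symm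

theorem oppositeSubgroup_permSubgroup :
    oppositeSubgroup (b.permSubgroup a) = b.op.permSubgroup a := by
  ext η
  rw [oppositeSubgroup, Subgroup.mem_centralizer_iff]
  constructor
  · intro h
    obtain ⟨w, hw⟩ := a.surjective (η (a b.dot.one))
    refine ⟨w, (b.op.permHom_eq_iff a).2 fun z => ?_⟩
    have hz := DFunLike.congr_fun (h _ (b.permHom_mem_permSubgroup a z)) (a b.dot.one)
    have hone : b.dot.mul z b.dot.one = z := mul_one (M := b.Dot) z
    rwa [Equiv.Perm.mul_apply, Equiv.Perm.mul_apply, permHom_apply, hone, ← hw,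
      permHom_apply] at hz
  · rintro ⟨y, rfl⟩ _ ⟨x, rfl⟩
    exact b.commute_permHom_op_permHom a x y

variable [Group G] {a} (ha : ∀ x y, a (b.circ.mul x y) = a x * a y)
include ha

theorem leftReg_mul_permHom_mul_inv (x y : B) :
    leftReg (a x) * b.permHom a y * (leftReg (a x))⁻¹ =
      b.permHom a (b.dot.mul (b.circ.mul x y) (b.dot.inv x)) := by
  rw [mul_inv_eq_iff_eq_mul]
  ext z
  obtain ⟨z, rfl⟩ := a.surjective z
  change a x * b.permHom a y (a z) = b.permHom a _ (a x * a z)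
  rw [permHom_apply, ← ha, ← ha, permHom_apply, b.brace_rel]

theorem isRegularStable_permSubgroup : IsRegularStable (b.permSubgroup a) where
  regular x y := by
    obtain ⟨x, rfl⟩ := a.surjective x
    obtain ⟨y, rfl⟩ := a.surjective y
    refine ((b.permEquiv a).bijective.existsUnique_iff).2 ?_
    change ∃! z : B, b.permHom a z (a x) = a y
    simp only [permHom_apply, a.apply_eq_iff_eq]
    exact ⟨b.dot.mul y (b.dot.inv x), inv_mul_cancel_right (G := b.Dot) y x,
      fun z hz => eq_mul_inv_of_mul_eq (G := b.Dot) hz⟩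
  stable x := by
    obtain ⟨x, rfl⟩ := a.surjective x
    rintro _ ⟨y, rfl⟩
    exact ⟨_, (b.leftReg_mul_permHom_mul_inv ha x y).symm⟩

theorem permHom_apply_one (x : B) : b.permHom a x 1 = a x := by
  have hone : a b.circ.one = 1 := map_one (MonoidHom.mk' (M := b.Circ) (G := G) a ha)
  rw [← hone, permHom_apply, circ_one]
  exact congrArg a (mul_one (M := b.Dot) x)

theorem isomorphic_brace_permSubgroup (h : IsRegularStable (b.permSubgroup a)) :
    b.Isomorphic h.brace := by
  refine ⟨(b.permEquiv a).toEquiv, (b.permEquiv a).map_mul, fun x y => ?_⟩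
  change _ = h.a.symm (h.a _ * h.a _)
  rw [Equiv.eq_symm_apply]
  change b.permHom a (b.circ.mul x y) 1 = b.permHom a x 1 * b.permHom a y 1
  simp only [b.permHom_apply_one ha, ha]

theorem braceEquivalent_permSubgroup_iff {C : Type w} {c : SkewBrace C} {a' : C ≃ G}
    (ha' : ∀ x y, a' (c.circ.mul x y) = a' x * a' y) :
    BraceEquivalent (b.permSubgroup a) (c.permSubgroup a') ↔ b.Isomorphic c := by
  constructor
  · rintro ⟨h, h', hi⟩
    exact ((b.isomorphic_brace_permSubgroup ha h).trans hi).trans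
      (c.isomorphic_brace_permSubgroup ha' h').symm
  · intro hi
    exact ⟨b.isRegularStable_permSubgroup ha, c.isRegularStable_permSubgroup ha',
      ((b.isomorphic_brace_permSubgroup ha _).symm.trans hi).trans
        (c.isomorphic_brace_permSubgroup ha' _)⟩

end RegularSubgroup

/-! ### The skew brace of a character -/

section CharBrace

variable {R : Type u} {A : Type v} [CommRing R] [AddCommGroup A]

/-- The skew left brace on `R × A` attached to a character `χ : A → R`: the dot group is the
semidirect product of `R` by `A`, in which `A` acts on `R` through multiplication by `χ`, and the
circle group is the direct product. -/
def charBrace (χ : AddChar A R) : SkewBrace (R × A) where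
  dot := by
    let : Mul (R × A) := ⟨fun x y => (x.1 + χ x.2 * y.1, x.2 + y.2)⟩
    let : Inv (R × A) := ⟨fun x => (-(χ (-x.2) * x.1), -x.2)⟩
    let : One (R × A) := ⟨(0, 0)⟩
    refine Group.ofLeftAxioms (fun x y z => Prod.ext ?_ (add_assoc _ _ _))
      (fun x => Prod.ext ?_ (zero_add _)) (fun x => Prod.ext ?_ (neg_add_cancel _))
    · change x.1 + χ x.2 * y.1 + χ (x.2 + y.2) * z.1 = x.1 + χ x.2 * (y.1 + χ y.2 * z.1)
      rw [AddChar.map_add_eq_mul]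
      ring
    · change 0 + χ 0 * x.1 = x.1
      rw [AddChar.map_zero_eq_one, one_mul, zero_add]
    · exact neg_add_cancel _
  circ := inferInstanceAs (Group (Multiplicative (R × A)))
  brace_rel x y z := by
    refine Prod.ext ?_ ?_
    · change x.1 + (y.1 + χ y.2 * z.1) = x.1 + y.1 + χ (x.2 + y.2) * -(χ (-x.2) * x.1) +
        χ (x.2 + y.2 + -x.2) * (x.1 + z.1)
      have hχ : χ x.2 * χ (-x.2) = 1 := by
        rw [← AddChar.map_add_eq_mul, add_neg_cancel, AddChar.map_zero_eq_one]
      rw [add_neg_cancel_comm, AddChar.map_add_eq_mul]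
      linear_combination χ y.2 * x.1 * hχ
    · change x.2 + (y.2 + z.2) = x.2 + y.2 + -x.2 + (x.2 + z.2)
      abel

namespace charBrace

variable (χ : AddChar A R)

theorem dot_mul (x y : R × A) :
    (charBrace χ).dot.mul x y = (x.1 + χ x.2 * y.1, x.2 + y.2) := rfl

theorem dot_inv (x : R × A) : (charBrace χ).dot.inv x = (-(χ (-x.2) * x.1), -x.2) := rfl

theorem circ_mul (x y : R × A) : (charBrace χ).circ.mul x y = x + y := rfl

/-- The normal subgroup `R` of the semidirect product. -/
def inl : AddChar R (charBrace χ).Dot where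
  toFun u := (u, 0)
  map_zero_eq_one' := rfl
  map_add_eq_mul' u v := by
    refine Prod.ext ?_ (add_zero 0).symm
    change u + v = u + χ 0 * v
    rw [AddChar.map_zero_eq_one, one_mul]

/-- The complement `A` of the semidirect product. -/
def inr : AddChar A (charBrace χ).Dot where
  toFun v := (0, v)
  map_zero_eq_one' := rfl
  map_add_eq_mul' u v := Prod.ext (by change 0 = 0 + χ u * 0; ring) rfl

variable {χ}

theorem inl_mul_inr (u : R) (v : A) : inl χ u * inr χ v = (u, v) :=
  Prod.ext (by change u + χ 0 * 0 = u; ring) (zero_add v)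

theorem exists_inl_mul_inr_eq (x : (charBrace χ).Dot) : ∃ u v, inl χ u * inr χ v = x :=
  ⟨x.1, x.2, inl_mul_inr x.1 x.2⟩

theorem inr_mul_inl (v : A) (u : R) : inr χ v * inl χ u = inl χ (χ v * u) * inr χ v :=
  (Prod.ext (zero_add _) (add_zero v)).trans (inl_mul_inr _ _).symm

theorem closure_pair_eq_top {u : R} {v : A} (hu : AddSubgroup.zmultiples u = ⊤)
    (hv : AddSubgroup.zmultiples v = ⊤) : Subgroup.closure {inl χ u, inr χ v} = ⊤ := by
  rw [eq_top_iff]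
  intro x _
  obtain ⟨r, a, rfl⟩ := exists_inl_mul_inr_eq x
  obtain ⟨m, rfl⟩ : r ∈ AddSubgroup.zmultiples u := hu ▸ AddSubgroup.mem_top r
  obtain ⟨n, rfl⟩ : a ∈ AddSubgroup.zmultiples v := hv ▸ AddSubgroup.mem_top a
  rw [AddChar.map_zsmul_eq_zpow, AddChar.map_zsmul_eq_zpow]
  exact mul_mem (zpow_mem (Subgroup.subset_closure (Set.mem_insert _ _)) m)
    (zpow_mem (Subgroup.subset_closure (Set.mem_insert_of_mem _ (Set.mem_singleton _))) n)

/-- The universal property of the semidirect product. -/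
def lift {H : Type*} [Group H] (α : AddChar R H) (β : AddChar A H)
    (h : ∀ u v, SemiconjBy (β v) (α u) (α (χ v * u))) : (charBrace χ).Dot →* H :=
  MonoidHom.mk' (fun x => α x.1 * β x.2) fun x y => by
    change α (x.1 + χ x.2 * y.1) * β (x.2 + y.2) = α x.1 * β x.2 * (α y.1 * β y.2)
    rw [AddChar.map_add_eq_mul, AddChar.map_add_eq_mul, mul_assoc (α x.1), mul_assoc (α x.1),
      ← mul_assoc (β x.2), (h y.1 x.2).eq, mul_assoc]

theorem lift_inl {H : Type*} [Group H] (α : AddChar R H) (β : AddChar A H)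
    (h : ∀ u v, SemiconjBy (β v) (α u) (α (χ v * u))) (u : R) : lift α β h (inl χ u) = α u :=
  (congrArg (α u * ·) β.map_zero_eq_one).trans (mul_one _)

theorem lift_inr {H : Type*} [Group H] (α : AddChar R H) (β : AddChar A H)
    (h : ∀ u v, SemiconjBy (β v) (α u) (α (χ v * u))) (v : A) : lift α β h (inr χ v) = β v :=
  (congrArg (· * β v) α.map_zero_eq_one).trans (one_mul _)

theorem isomorphic_mulShift {A : Type v} [CommRing A] (χ : AddChar A R) (t : Aˣ) :
    (charBrace (χ.mulShift t)).Isomorphic (charBrace χ) :=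
  ⟨(Equiv.refl R).prodCongr t.mulLeft,
    fun _ _ => Prod.ext rfl (mul_add _ _ _), fun _ _ => Prod.ext rfl (mul_add _ _ _)⟩

end charBrace

end CharBrace

/-! ### Skew braces with commutative circle group -/

section Field

variable {F : Type u} [Field F]

theorem exists_eq_mul_of_mul_comm {X : Type*} {u w : X → F}
    (h : ∀ x y, u x * w y = u y * w x) {x₀ : X} (hx₀ : w x₀ ≠ 0) : ∃ k, ∀ x, u x = k * w x :=
  ⟨u x₀ / w x₀, fun x => by field_simp; exact h x x₀⟩

-- The relation makes `θ - 1` a multiple `K * u` of `u`; if `K` were not zero, then `θ` would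
-- vanish where `u` takes the value `-K⁻¹`.
theorem eq_one_of_sub_one_mul_comm {X : Type*} {θ u : X → F} (hθ : ∀ x, θ x ≠ 0)
    (hu : Function.Surjective u) (h : ∀ x y, (θ x - 1) * u y = (θ y - 1) * u x) (x : X) :
    θ x = 1 := by
  obtain ⟨x₁, hx₁⟩ := hu 1
  obtain ⟨K, hK⟩ := exists_eq_mul_of_mul_comm (u := fun x => θ x - 1) h (hx₁ ▸ one_ne_zero)
  by_cases hK0 : K = 0
  · simpa [hK0, sub_eq_zero] using hK x
  · obtain ⟨y, hy⟩ := hu (-K⁻¹)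
    exact absurd (by simpa [hy, hK0] using hK y) (hθ y)

end Field

section Shear

variable {R : Type u} {A : Type v} [CommRing R] [AddCommGroup A]

/-- Conjugation by `(-k, 0)` in the dot group of `charBrace χ`. It moves the complement `A` of `R`
to its conjugates. -/
def shear (χ : AddChar A R) (k : R) : R × A ≃ R × A where
  toFun x := (x.1 + k * (χ x.2 - 1), x.2)
  invFun x := (x.1 - k * (χ x.2 - 1), x.2)
  left_inv _ := Prod.ext (add_sub_cancel_right _ _) rfl
  right_inv _ := Prod.ext (sub_add_cancel _ _) rfl

theorem shear_apply (χ : AddChar A R) (k : R) (x : R × A) :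
    shear χ k x = (x.1 + k * (χ x.2 - 1), x.2) := rfl

theorem shear_dot_mul (χ : AddChar A R) (k : R) (x y : R × A) :
    shear χ k ((charBrace χ).dot.mul x y) =
      (charBrace χ).dot.mul (shear χ k x) (shear χ k y) := by
  refine Prod.ext ?_ rfl
  simp only [shear_apply, charBrace.dot_mul, AddChar.map_add_eq_mul]
  ring

end Shear

section CommutativeCircle

variable {F : Type u} {A : Type v} [Field F] [AddCommGroup A] {χ : AddChar A F}
  {b : SkewBrace (F × A)} (hdot : b.dot = (charBrace χ).dot) {r s : F × A → F}
  (hlam : ∀ x y, b.lam x y = (r x * y.1 + s x * (χ y.2 - 1), y.2))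

include hdot hlam in
theorem circ_mul_eq_of_lam_eq (x y : F × A) :
    b.circ.mul x y = (x.1 + χ x.2 * (r x * y.1 + s x * (χ y.2 - 1)), x.2 + y.2) := by
  rw [← dot_mul_lam, hdot, charBrace.dot_mul, hlam]

include hdot hlam in
theorem isomorphic_charBrace_of_lam_eq {k : F} (hs : ∀ x, s x = k * (r x - 1))
    (hr : ∀ x, χ x.2 * r x = 1) : b.Isomorphic (charBrace χ) := by
  refine ⟨shear χ k, fun x y => hdot ▸ shear_dot_mul χ k x y, fun x y => ?_⟩
  rw [circ_mul_eq_of_lam_eq hdot hlam]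
  refine Prod.ext ?_ rfl
  simp only [charBrace.circ_mul, shear_apply, Prod.fst_add,
    AddChar.map_add_eq_mul, hs]
  linear_combination (y.1 + k * (χ y.2 - 1)) * hr x

include hdot hlam in
theorem isomorphic_op_charBrace_of_lam_eq {k : F} (hr : ∀ x, r x = 1)
    (hs : ∀ x, χ x.2 * s x - x.1 = k * (χ x.2 - 1)) : b.Isomorphic (charBrace χ).op := by
  refine isomorphic_op_of_dot_inv (shear χ k) (fun x y => hdot ▸ shear_dot_mul χ k x y)
    fun x y => ?_
  have hx : χ x.2 ≠ 0 := (χ.val_isUnit x.2).ne_zero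
  have hy : χ y.2 ≠ 0 := (χ.val_isUnit y.2).ne_zero
  simp only [circ_mul_eq_of_lam_eq hdot hlam, charBrace.circ_mul, charBrace.dot_inv, shear_apply,
    AddChar.map_neg_eq_inv, AddChar.map_add_eq_mul, hr]
  refine Prod.ext ?_ (neg_add _ _)
  rw [Prod.fst_add]
  field_simp
  linear_combination (1 - χ y.2) * hs x

variable (hcomm : ∀ x y, b.circ.mul x y = b.circ.mul y x)

include hlam hcomm in
theorem sub_one_mul_comm_of_lam_eq (hχ : χ ≠ 1) (x y : F × A) :
    s x * (r y - 1) = s y * (r x - 1) := by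
  obtain ⟨v, hv⟩ := AddChar.ne_one_iff.1 hχ
  have hlam_comm : b.lam x (b.lam y (0, v)) = b.lam y (b.lam x (0, v)) := by
    rw [← b.lam_circ_mul, hcomm, b.lam_circ_mul]
  have hfst := congrArg Prod.fst hlam_comm
  simp only [hlam] at hfst
  apply mul_right_cancel₀ (sub_ne_zero.2 hv)
  linear_combination -hfst

include hdot hlam hcomm in
-- The automorphisms `λ_x` commute, hence either they all fix the same complement of `F` or they
-- are all inner.
theorem isomorphic_or_isomorphic_op_of_lam_eq (hχ : χ ≠ 1) (hr : ∀ x, r x ≠ 0) :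
    b.Isomorphic (charBrace χ) ∨ b.Isomorphic (charBrace χ).op := by
  have hfst (x y : F × A) : x.1 + χ x.2 * (r x * y.1 + s x * (χ y.2 - 1)) =
      y.1 + χ y.2 * (r y * x.1 + s y * (χ x.2 - 1)) := by
    have h := congrArg Prod.fst (hcomm x y)
    rwa [circ_mul_eq_of_lam_eq hdot hlam, circ_mul_eq_of_lam_eq hdot hlam] at h
  by_cases hr1 : ∀ x, r x = 1
  · right
    obtain ⟨v, hv⟩ := AddChar.ne_one_iff.1 hχ
    obtain ⟨k, hk⟩ := exists_eq_mul_of_mul_comm (u := fun x : F × A => χ x.2 * s x - x.1)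
      (w := fun x => χ x.2 - 1) (x₀ := (0, v))
      (fun x y => by have h := hfst x y; rw [hr1, hr1] at h; linear_combination h)
      (sub_ne_zero.2 hv)
    exact isomorphic_op_charBrace_of_lam_eq hdot hlam hr1 hk
  · left
    push Not at hr1
    obtain ⟨x₀, hx₀⟩ := hr1
    obtain ⟨k, hk⟩ := exists_eq_mul_of_mul_comm (w := fun x => r x - 1)
      (sub_one_mul_comm_of_lam_eq hlam hcomm hχ) (sub_ne_zero.2 hx₀)
    refine isomorphic_charBrace_of_lam_eq hdot hlam hk
      (eq_one_of_sub_one_mul_comm (u := fun x => (shear χ k x).1)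
        (fun x => mul_ne_zero (χ.val_isUnit x.2).ne_zero (hr x))
        (Prod.fst_surjective.comp (shear χ k).surjective) fun x y => ?_)
    have h := hfst x y
    rw [hk x, hk y] at h
    simp only [shear_apply]
    linear_combination h

end CommutativeCircle

section PrimeField

variable {p : ℕ} [Fact p.Prime] {A : Type v} [AddCommGroup A] {χ : AddChar A (ZMod p)}

theorem addChar_ne_one_of_injective {R : Type*} [CommMonoid R] [Nontrivial A] {χ : AddChar A R}
    (hχ : Function.Injective χ) : χ ≠ 1 := by
  rintro rfl
  obtain ⟨v, hv⟩ := exists_ne (0 : A)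
  exact hv (hχ rfl)

theorem prime_nsmul_eq_self (hχ : Function.Injective χ) (a : A) : p • a = a :=
  hχ (by rw [AddChar.map_nsmul_eq_pow, ZMod.pow_card])

theorem addMonoidHom_from_zmod_eq_zero (hχ : Function.Injective χ) (f : ZMod p →+ A) : f = 0 := by
  ext x
  rw [← prime_nsmul_eq_self hχ (f x), ← map_nsmul, nsmul_eq_mul, CharP.cast_eq_zero, zero_mul,
    map_zero, AddMonoidHom.zero_apply]

theorem addMonoidHom_to_zmod_eq_zero (hχ : Function.Injective χ) (f : A →+ ZMod p) : f = 0 := by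
  ext a
  rw [← prime_nsmul_eq_self hχ a, map_nsmul, nsmul_eq_mul, CharP.cast_eq_zero, zero_mul,
    AddMonoidHom.zero_apply]

-- An isomorphism would preserve both factors of the circle group `ZMod p × A`, while on the dot
-- groups it would turn `(0, v) · (1, 0) = (χ v, v)` into a product in the opposite order.
theorem not_isomorphic_op_charBrace [Nontrivial A] (hχ : Function.Injective χ) :
    ¬ (charBrace χ).Isomorphic (charBrace χ).op := by
  rintro ⟨e, hdot, hcirc⟩
  let f : ZMod p × A →+ ZMod p × A := AddMonoidHom.mk' e hcirc
  have hsnd (a : ZMod p) : (e (a, 0)).2 = 0 := DFunLike.congr_fun (addMonoidHom_from_zmod_eq_zero hχ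
    ((AddMonoidHom.snd _ _).comp (f.comp (AddMonoidHom.inl _ _)))) a
  have hfst (v : A) : (e (0, v)).1 = 0 := DFunLike.congr_fun (addMonoidHom_to_zmod_eq_zero hχ
    ((AddMonoidHom.fst _ _).comp (f.comp (AddMonoidHom.inr _ _)))) v
  have hfst_add (a : ZMod p) (v : A) : (e (a, v)).1 = (e (a, 0)).1 := by
    have h := congrArg Prod.fst (hcirc (a, 0) (0, v))
    simpa [charBrace.circ_mul, op_circ_mul, hfst] using h
  obtain ⟨v, hv⟩ := AddChar.ne_one_iff.1 (addChar_ne_one_of_injective hχ)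
  have hχv : (e (χ v, 0)).1 = (e (1, 0)).1 := by
    have h := congrArg Prod.fst (hdot (0, v) (1, 0))
    simpa [op_dot_mul, charBrace.dot_mul, hfst, hfst_add] using h
  exact hv (congrArg Prod.fst (e.injective (Prod.ext hχv ((hsnd _).trans (hsnd _).symm))))

theorem exists_eq_of_map_dot_mul [Nontrivial A] (hχ : Function.Injective χ)
    {f : ZMod p × A → ZMod p × A} (hinj : Function.Injective f)
    (hf : ∀ x y, f ((charBrace χ).dot.mul x y) = (charBrace χ).dot.mul (f x) (f y)) :
    ∃ r s : ZMod p, r ≠ 0 ∧ ∀ x, f x = (r * x.1 + s * (χ x.2 - 1), x.2) := by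
  simp only [charBrace.dot_mul] at hf
  have hsnd (a : ZMod p) : (f (a, 0)).2 = 0 := DFunLike.congr_fun (addMonoidHom_from_zmod_eq_zero hχ
    (AddMonoidHom.mk' (fun a => (f (a, 0)).2) fun a b => by
      simpa using congrArg Prod.snd (hf (a, 0) (b, 0)))) a
  have hfst (a : ZMod p) : (f (a, 0)).1 = a * (f (1, 0)).1 := by
    simpa using ZMod.map_smul (AddMonoidHom.mk' (fun a => (f (a, 0)).1) fun a b => by
      simpa [hsnd] using congrArg Prod.fst (hf (a, 0) (b, 0))) a 1
  set r := (f (1, 0)).1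
  have hr0 : r ≠ 0 := by
    intro h
    have hzero : f (1, 0) = f (0, 0) :=
      Prod.ext (by rw [hfst, hfst 0, h, mul_zero, mul_zero]) (by rw [hsnd, hsnd])
    exact one_ne_zero (congrArg Prod.fst (hinj hzero))
  have hprod (a : ZMod p) (v : A) : f (a, v) = (r * a + (f (0, v)).1, (f (0, v)).2) := by
    simpa [hfst a, hsnd, mul_comm] using hf (a, 0) (0, v)
  have hcompl (v : A) : (f (0, v)).2 = v := by
    have h := congrArg Prod.fst (hf (0, v) (1, 0))
    simp only [zero_add, mul_one, add_zero] at h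
    rw [hprod] at h
    apply hχ
    apply mul_left_cancel₀ hr0
    linear_combination -h
  obtain ⟨v₀, hv₀⟩ := AddChar.ne_one_iff.1 (addChar_ne_one_of_injective hχ)
  obtain ⟨s, hs⟩ := exists_eq_mul_of_mul_comm (u := fun v => (f (0, v)).1) (w := fun v => χ v - 1)
    (fun v w => by
      have h := congrArg Prod.fst (hf (0, v) (0, w))
      have h' := congrArg Prod.fst (hf (0, w) (0, v))
      simp only [zero_add, mul_zero, hcompl, add_comm w v] at h h'
      linear_combination h - h') (sub_ne_zero.2 hv₀)
  exact ⟨r, s, hr0, fun x => by rw [← hs, hprod, hcompl]⟩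

end PrimeField

section Classification

variable {p : ℕ} [Fact p.Prime] {A : Type v} [AddCommGroup A] [Nontrivial A]
  {χ : AddChar A (ZMod p)}

theorem isomorphic_or_isomorphic_op_charBrace (hχ : Function.Injective χ) {B : Type w}
    {b : SkewBrace B} (f : b.Dot ≃* (charBrace χ).Dot)
    (hcomm : ∀ x y, b.circ.mul x y = b.circ.mul y x) :
    b.Isomorphic (charBrace χ) ∨ b.Isomorphic (charBrace χ).op := by
  let e : ZMod p × A ≃ B := f.symm.toEquiv
  have hdot : (b.transport e).dot = (charBrace χ).dot := by
    refine Group.ext (funext₂ fun x y => ?_)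
    exact (f.map_mul _ _).trans (congrArg₂ _ (f.apply_symm_apply x) (f.apply_symm_apply y))
  choose r s hr hlam using fun x => exists_eq_of_map_dot_mul hχ ((b.transport e).lam_injective x)
    (hdot ▸ (b.transport e).lam_dot_mul x)
  exact (isomorphic_or_isomorphic_op_of_lam_eq hdot hlam (fun x y => congrArg e.symm (hcomm _ _))
    (addChar_ne_one_of_injective hχ) hr).imp
    (b.transport_isomorphic e).symm.trans (b.transport_isomorphic e).symm.trans

theorem encard_braceClasses (hχ : Function.Injective χ) {M K : Type*} [Group M] [Group K]
    (f : (charBrace χ).Dot ≃* M) (k : (charBrace χ).Circ ≃* K) :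
    (braceClasses.{max v w} M K).encard = 2 := by
  refine Set.encard_eq_two.2 ⟨isoClass.{v, w} (charBrace χ), isoClass.{v, w} (charBrace χ).op,
    fun h => not_isomorphic_op_charBrace hχ (isoClass_eq_isoClass_iff.1 h), Set.Subset.antisymm ?_
    (Set.pair_subset (isoClass_mem_braceClasses f k)
      (isoClass_mem_braceClasses ((opDotEquiv _).trans f) k))⟩
  rintro _ ⟨⟨B, b⟩, ⟨f'⟩, ⟨k'⟩, rfl⟩
  let c := k'.trans k.symm
  have hcomm (x y : B) : b.circ.mul x y = b.circ.mul y x :=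
    c.injective ((c.map_mul x y).trans ((add_comm (G := ZMod p × A) (c x) (c y)).trans
      (c.map_mul y x).symm))
  exact (isomorphic_or_isomorphic_op_charBrace hχ (f'.trans f.symm) hcomm).imp
    mk_eq_isoClass_iff.2 mk_eq_isoClass_iff.2

end Classification

/-! ### The metacyclic group as a dot group -/

section MetacyclicGroup

theorem zmultiples_one_zmod (n : ℕ) : AddSubgroup.zmultiples (1 : ZMod n) = ⊤ :=
  (AddSubgroup.eq_top_iff' _).2 fun u =>
    have ⟨k, hk⟩ := ZMod.intCast_surjective u
    hk ▸ AddSubgroup.intCast_mem_zmultiples_one k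

theorem zmultiples_neg_one_zmod (n : ℕ) : AddSubgroup.zmultiples (-1 : ZMod n) = ⊤ := by
  rw [AddSubgroup.zmultiples_neg, zmultiples_one_zmod]

/-- The character `k ↦ x ^ k` of `ZMod n` attached to an element `x` with `x ^ n = 1` of a group,
which need not be commutative. -/
def zpowChar {H : Type*} [Group H] {n : ℕ} {x : H} (hx : x ^ n = 1) : AddChar (ZMod n) H :=
  AddChar.toAddMonoidHomEquiv.symm
    (ZMod.lift n ⟨zmultiplesHom _ (Additive.ofMul x), (natCast_zsmul _ _).trans hx⟩)

theorem zpowChar_one {H : Type*} [Group H] {n : ℕ} {x : H} (hx : x ^ n = 1) :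
    zpowChar hx 1 = x := by
  have h := ZMod.lift_coe n ⟨zmultiplesHom _ (Additive.ofMul x), (natCast_zsmul _ _).trans hx⟩ 1
  rw [Int.cast_one] at h
  exact h.trans (one_zsmul _)

theorem semiconjBy_addChar_zmod {H : Type*} [Group H] {m n : ℕ} [NeZero n]
    {χ : AddChar (ZMod n) (ZMod m)} {α : AddChar (ZMod m) H} {β : AddChar (ZMod n) H}
    (h : SemiconjBy (β 1) (α 1) (α (χ 1))) (u : ZMod m) (v : ZMod n) :
    SemiconjBy (β v) (α u) (α (χ v * u)) := by
  have hone (u : ZMod m) : SemiconjBy (β 1) (α u) (α (χ 1 * u)) := by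
    obtain ⟨k, rfl⟩ := ZMod.intCast_surjective u
    rw [← zsmul_one, mul_smul_comm, mul_one, AddChar.map_zsmul_eq_zpow, AddChar.map_zsmul_eq_zpow]
    exact h.zpow_right k
  obtain ⟨k, rfl⟩ := ZMod.natCast_zmod_surjective v
  induction k with
  | zero =>
    rw [Nat.cast_zero, AddChar.map_zero_eq_one, AddChar.map_zero_eq_one, one_mul]
    exact SemiconjBy.one_left _
  | succ k ih =>
    rw [Nat.cast_succ, add_comm, AddChar.map_add_eq_mul, AddChar.map_add_eq_mul, mul_assoc]
    exact (hone _).mul_left ih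

variable {p q : ℕ} {g : ℤ} {χ : AddChar (ZMod q) (ZMod p)}

/-- The homomorphism from the metacyclic group to the dot group of `charBrace χ` that sends the
two generators to generators of the two factors. -/
def metacyclicGroupHom (hχ : χ 1 = g) : MetacyclicGroup p q g →* (charBrace χ).Dot :=
  PresentedGroup.toGroup (f := ![charBrace.inl χ 1, charBrace.inr χ 1]) (by
    have hinl : charBrace.inl χ g = charBrace.inl χ 1 ^ g := by
      rw [← AddChar.map_zsmul_eq_zpow, zsmul_one]
    have hconj : charBrace.inr χ 1 * charBrace.inl χ 1 =
        charBrace.inl χ 1 ^ g * charBrace.inr χ 1 := by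
      rw [charBrace.inr_mul_inl, mul_one, hχ, hinl]
    rintro r (rfl | rfl | rfl)
    · simp [← AddChar.map_nsmul_eq_pow]
    · simp [← AddChar.map_nsmul_eq_pow]
    · simp [hconj])

theorem metacyclicGroupHom_of_zero (hχ : χ 1 = g) :
    metacyclicGroupHom hχ (PresentedGroup.of 0) = charBrace.inl χ 1 :=
  PresentedGroup.toGroup.of _

theorem metacyclicGroupHom_of_one (hχ : χ 1 = g) :
    metacyclicGroupHom hχ (PresentedGroup.of 1) = charBrace.inr χ 1 :=
  PresentedGroup.toGroup.of _

theorem metacyclicGroupHom_surjective (hχ : χ 1 = g) :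
    Function.Surjective (metacyclicGroupHom hχ) := by
  rw [← MonoidHom.range_eq_top, eq_top_iff,
    ← charBrace.closure_pair_eq_top (zmultiples_one_zmod p) (zmultiples_one_zmod q),
    Subgroup.closure_le, Set.pair_subset_iff]
  exact ⟨⟨_, metacyclicGroupHom_of_zero hχ⟩, ⟨_, metacyclicGroupHom_of_one hχ⟩⟩

theorem metacyclicGroupHom_injective [NeZero q] (hχ : χ 1 = g) :
    Function.Injective (metacyclicGroupHom hχ) := by
  let σ : MetacyclicGroup p q g := PresentedGroup.of 0
  let τ : MetacyclicGroup p q g := PresentedGroup.of 1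
  have hσ : σ ^ p = 1 := PresentedGroup.one_of_mem (Or.inl rfl)
  have hτ : τ ^ q = 1 := PresentedGroup.one_of_mem (Or.inr (Or.inl rfl))
  have hστ : τ * σ * τ⁻¹ * (σ ^ g)⁻¹ = 1 := PresentedGroup.one_of_mem (Or.inr (Or.inr rfl))
  have hsemi : SemiconjBy (zpowChar hτ 1) (zpowChar hσ 1) (zpowChar hσ (χ 1)) := by
    rw [hχ, ← zsmul_one g, AddChar.map_zsmul_eq_zpow, zpowChar_one, zpowChar_one]
    exact mul_inv_eq_iff_eq_mul.1 (mul_inv_eq_one.1 hστ)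
  let k : (charBrace χ).Dot →* MetacyclicGroup p q g :=
    charBrace.lift (zpowChar hσ) (zpowChar hτ) (semiconjBy_addChar_zmod hsemi)
  have hk : k.comp (metacyclicGroupHom hχ) = MonoidHom.id _ := by
    refine PresentedGroup.ext fun i => ?_
    fin_cases i
    · exact (congrArg k (metacyclicGroupHom_of_zero hχ)).trans
        ((charBrace.lift_inl _ _ _ 1).trans (zpowChar_one hσ))
    · exact (congrArg k (metacyclicGroupHom_of_one hχ)).trans
        ((charBrace.lift_inr _ _ _ 1).trans (zpowChar_one hτ))
  exact Function.LeftInverse.injective (g := k) (DFunLike.congr_fun hk)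

/-- The dot group of `charBrace χ`, as a metacyclic group. -/
noncomputable def dotEquivMetacyclicGroup [NeZero q] (hχ : χ 1 = g) :
    (charBrace χ).Dot ≃* MetacyclicGroup p q g :=
  (MulEquiv.ofBijective (metacyclicGroupHom hχ)
    ⟨metacyclicGroupHom_injective hχ, metacyclicGroupHom_surjective hχ⟩).symm

/-- The circle group of `charBrace χ`, as a cyclic group. -/
def circEquivOfCoprime (χ : AddChar (ZMod q) (ZMod p)) (hpq : p.Coprime q) :
    (charBrace χ).Circ ≃* Multiplicative (ZMod (p * q)) :=
  (AddEquiv.toMultiplicative (ZMod.chineseRemainder hpq).toAddEquiv).symm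

end MetacyclicGroup

section PowChar

variable {n : ℕ} [NeZero n]

/-- The character `k ↦ ζ ^ k` of `ZMod n` attached to an element `ζ` of order `n`. -/
noncomputable def powChar {C : Type*} [CommMonoid C] {ζ : C} (hζ : orderOf ζ = n) :
    AddChar (ZMod n) C :=
  AddChar.zmodChar n (hζ ▸ pow_orderOf_eq_one ζ)

theorem powChar_natCast {C : Type*} [CommMonoid C] {ζ : C} (hζ : orderOf ζ = n) (k : ℕ) :
    powChar hζ k = ζ ^ k :=
  AddChar.zmodChar_apply' _ k

theorem powChar_one {C : Type*} [CommMonoid C] {ζ : C} (hζ : orderOf ζ = n) :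
    powChar hζ 1 = ζ := by
  rw [← Nat.cast_one, powChar_natCast, pow_one]

theorem powChar_intCast {F : Type*} [Field F] {ζ : F} (hζ : orderOf ζ = n) (k : ℤ) :
    powChar hζ k = ζ ^ k := by
  rw [← zsmul_one, AddChar.map_zsmul_eq_zpow, powChar_one]

theorem powChar_injective {C : Type*} [CommMonoid C] {ζ : C} (hζ : orderOf ζ = n) :
    Function.Injective (powChar hζ) := fun a b h =>
  ZMod.val_injective n (pow_injOn_Iio_orderOf (hζ ▸ ZMod.val_lt a) (hζ ▸ ZMod.val_lt b) h)

end PowChar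

theorem encard_braceClasses_metacyclicGroup {p q : ℕ} [Fact p.Prime] (hq : 1 < q) {g : ℤ}
    (hg : orderOf (g : ZMod p) = q) :
    (braceClasses.{v} (MetacyclicGroup p q g) (Multiplicative (ZMod (p * q)))).encard = 2 := by
  have : NeZero q := ⟨by omega⟩
  have : Nontrivial (ZMod q) := ZMod.nontrivial_iff.2 hq.ne'
  have hg0 : (g : ZMod p) ≠ 0 := by
    rintro h0
    rw [h0, orderOf_zero] at hg
    omega
  have hpq : p.Coprime q :=
    Nat.Coprime.coprime_dvd_right (hg ▸ ZMod.orderOf_dvd_card_sub_one hg0)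
      ((Nat.coprime_self_sub_right (Fact.out : p.Prime).one_le).2 (Nat.coprime_one_right p))
  exact encard_braceClasses.{0, v} (powChar_injective hg)
    (dotEquivMetacyclicGroup (powChar_one hg)) (circEquivOfCoprime _ hpq)

end SkewBrace

section Coordinates

variable {G : Type u} [Group G] {p q : ℕ} [Fact p.Prime] [Fact q.Prime] {σ τ : G}

namespace IsCyclicPQ

theorem coord_add (hqp : q < p) (hG : IsCyclicPQ p q σ τ) (x y : ZMod p × ZMod q) :
    hG.coord hqp (x + y) = hG.coord hqp x * hG.coord hqp y := by
  obtain ⟨a, b⟩ := x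
  obtain ⟨c, d⟩ := y
  obtain ⟨a, rfl⟩ := ZMod.intCast_surjective a
  obtain ⟨b, rfl⟩ := ZMod.intCast_surjective b
  obtain ⟨c, rfl⟩ := ZMod.intCast_surjective c
  obtain ⟨d, rfl⟩ := ZMod.intCast_surjective d
  rw [Prod.mk_add_mk, ← Int.cast_add, ← Int.cast_add, coord_intCast, coord_intCast,
    coord_intCast, zpow_add, zpow_add]
  exact ((hG.commute.zpow_zpow c b).symm.mul_mul_mul_comm _ _).symm

theorem coord_one_zero (hqp : q < p) (hG : IsCyclicPQ p q σ τ) : hG.coord hqp (1, 0) = σ := by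
  simpa using hG.coord_intCast hqp 1 0

theorem coord_zero_one (hqp : q < p) (hG : IsCyclicPQ p q σ τ) : hG.coord hqp (0, 1) = τ := by
  simpa using hG.coord_intCast hqp 0 1

end IsCyclicPQ

end Coordinates

namespace SkewBrace

/-! ### The two families of regular subgroups -/

section FamilyChar

variable {p q : ℕ} {g : ℤ}

/-- The character `v ↦ g ^ (-t v)`, whose `charBrace` is the skew left brace of `N_t`. The exponent
of `π_t` is negated because `π_t` sends the `τ`-exponent `v` to `v - 1`. -/
noncomputable def familyChar [NeZero q] (hg : orderOf (g : ZMod p) = q) (t : ℕ) :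
    AddChar (ZMod q) (ZMod p) :=
  (powChar hg).mulShift (-(t : ZMod q))

theorem familyChar_neg_one [NeZero q] (hg : orderOf (g : ZMod p) = q) (t : ℕ) :
    familyChar hg t (-1) = (g : ZMod p) ^ t := by
  rw [familyChar, AddChar.mulShift_apply, neg_mul_neg, mul_one, powChar_natCast]

theorem familyChar_apply [Fact p.Prime] [NeZero q] (hg : orderOf (g : ZMod p) = q) (t : ℕ)
    (v : ZMod q) :
    familyChar hg t v = (g : ZMod p) ^ (-((t : ℤ) * (v.val : ℤ))) := by
  rw [familyChar, AddChar.mulShift_apply, ← powChar_intCast hg]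
  push_cast
  rw [ZMod.natCast_zmod_val, neg_mul]

theorem natCast_ne_zero_of_mem_Icc {n t : ℕ} (ht : t ∈ Finset.Icc 1 (n - 1)) :
    (t : ZMod n) ≠ 0 := by
  rw [Finset.mem_Icc] at ht
  rw [Ne, ZMod.natCast_eq_zero_iff]
  exact fun h => absurd (Nat.le_of_dvd (by omega) h) (by omega)

theorem charBrace_familyChar_isomorphic [Fact q.Prime] (hg : orderOf (g : ZMod p) = q) {t : ℕ}
    (ht : t ∈ Finset.Icc 1 (q - 1)) :
    (charBrace (familyChar hg t)).Isomorphic (charBrace (powChar hg)) :=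
  charBrace.isomorphic_mulShift _
    (Units.mk0 _ (neg_ne_zero.2 (natCast_ne_zero_of_mem_Icc ht)))

end FamilyChar

section Families

variable {G : Type u} [Group G] {p q : ℕ} [Fact p.Prime] [Fact q.Prime] {σ τ : G} {g : ℤ}
  (hqp : q < p) (hG : IsCyclicPQ p q σ τ)

theorem permHom_coord_inl_one (χ : AddChar (ZMod q) (ZMod p)) :
    (charBrace χ).permHom (hG.coord hqp) (charBrace.inl χ 1) = leftReg σ := by
  refine (permHom_eq_iff _ _).2 fun y => ?_
  have hinl : (charBrace χ).dot.mul (charBrace.inl χ 1) y = (1, 0) + y :=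
    Prod.ext (by change 1 + χ 0 * y.1 = 1 + y.1; simp) rfl
  rw [hinl, hG.coord_add, hG.coord_one_zero]
  rfl

theorem op_permHom_coord_inr_one (χ : AddChar (ZMod q) (ZMod p)) :
    (charBrace χ).op.permHom (hG.coord hqp) (charBrace.inr χ 1) = leftReg τ := by
  refine (permHom_eq_iff _ _).2 fun y => ?_
  have hinr : (charBrace χ).op.dot.mul (charBrace.inr χ 1) y = (0, 1) + y :=
    Prod.ext (by change y.1 + χ y.2 * 0 = 0 + y.1; ring) (add_comm y.2 1)
  rw [hinr, hG.coord_add, hG.coord_zero_one]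
  rfl

variable (hg : orderOf (g : ZMod p) = q) (t : ℕ)

theorem permHom_coord_inr_neg_one :
    (charBrace (familyChar hg t)).permHom (hG.coord hqp)
      (charBrace.inr (familyChar hg t) (-1)) = piPerm hqp hG hg t := by
  refine (permHom_eq_iff _ _).2 fun y => ?_
  rw [piPerm, Equiv.permCongr_apply, Equiv.symm_apply_apply]
  refine congrArg _ (Prod.ext ?_ (neg_add_eq_sub _ _))
  change 0 + familyChar hg t (-1) * y.1 = y.1 * (g : ZMod p) ^ t
  rw [familyChar_neg_one, zero_add, mul_comm]

theorem op_permHom_coord_inl_one :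
    (charBrace (familyChar hg t)).op.permHom (hG.coord hqp)
      (charBrace.inl (familyChar hg t) 1) = etaPerm hqp hG g t := by
  refine (permHom_eq_iff _ _).2 fun y => ?_
  rw [etaPerm, Equiv.permCongr_apply, Equiv.symm_apply_apply]
  refine congrArg _ (Prod.ext ?_ (add_zero _))
  change y.1 + familyChar hg t y.2 * 1 = y.1 + (g : ZMod p) ^ (-((t : ℤ) * (y.2.val : ℤ)))
  rw [familyChar_apply, mul_one]

theorem familyN_eq_permSubgroup :
    familyN hqp hG hg t = (charBrace (familyChar hg t)).permSubgroup (hG.coord hqp) := by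
  rw [familyN, ← permHom_coord_inl_one hqp hG (familyChar hg t), ← permHom_coord_inr_neg_one]
  exact closure_permHom_pair _ _ (charBrace.closure_pair_eq_top
    (zmultiples_one_zmod p) (zmultiples_neg_one_zmod q))

theorem familyN'_eq_permSubgroup :
    familyN' hqp hG hg t = (charBrace (familyChar hg t)).op.permSubgroup (hG.coord hqp) := by
  rw [familyN', familyN_eq_permSubgroup, oppositeSubgroup_permSubgroup]

theorem familyN'_eq_closure :
    familyN' hqp hG hg t = Subgroup.closure {etaPerm hqp hG g t, leftReg τ} := by
  rw [familyN'_eq_permSubgroup, ← op_permHom_coord_inl_one hqp hG hg,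
    ← op_permHom_coord_inr_one hqp hG (familyChar hg t)]
  exact (closure_permHom_pair _ _ (closure_op_dot_eq_top
    (charBrace.closure_pair_eq_top (zmultiples_one_zmod p) (zmultiples_one_zmod q)))).symm

end Families

end SkewBrace

theorem mainTheorem4 {G : Type u} [Group G] {p q : ℕ} [Fact p.Prime] [Fact q.Prime]
    (hqp : q < p) (hmod : p ≡ 1 [MOD q])
    {g : ℤ} (hg : orderOf (g : ZMod p) = q)
    {σ τ : G} (hG : IsCyclicPQ p q σ τ) :
    -- the members of both families are regular `G`-stable subgroups isomorphic to `M`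
    (∀ t ∈ Finset.Icc 1 (q - 1),
      (IsRegularStable (familyN hqp hG hg t) ∧
        Nonempty (familyN hqp hG hg t ≃* MetacyclicGroup p q g)) ∧
      (IsRegularStable (familyN' hqp hG hg t) ∧
        Nonempty (familyN' hqp hG hg t ≃* MetacyclicGroup p q g)) ∧
      familyN' hqp hG hg t = Subgroup.closure {etaPerm hqp hG g t, leftReg τ}) ∧
    -- brace equivalence within and between the families
    (∀ s ∈ Finset.Icc 1 (q - 1), ∀ t ∈ Finset.Icc 1 (q - 1),
      BraceEquivalent (familyN hqp hG hg s) (familyN hqp hG hg t) ∧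
      BraceEquivalent (familyN' hqp hG hg s) (familyN' hqp hG hg t) ∧
      ¬ BraceEquivalent (familyN hqp hG hg s) (familyN' hqp hG hg t)) ∧
    -- there are exactly two isomorphism classes of skew left braces of this kind
    (braceClasses.{v} (MetacyclicGroup p q g) (Multiplicative (ZMod (p * q)))).encard = 2 := by
  have ha := hG.coord_add hqp
  have hiso {t : ℕ} (ht : t ∈ Finset.Icc 1 (q - 1)) :=
    SkewBrace.charBrace_familyChar_isomorphic hg ht
  have eM := SkewBrace.dotEquivMetacyclicGroup (SkewBrace.powChar_one hg)
  refine ⟨fun t ht => ?_, fun s hs t ht => ?_,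
    SkewBrace.encard_braceClasses_metacyclicGroup (Fact.out : q.Prime).one_lt hg⟩
  · obtain ⟨e⟩ := (hiso ht).nonempty_dot
    refine ⟨?_, ?_, SkewBrace.familyN'_eq_closure hqp hG hg t⟩
    · rw [SkewBrace.familyN_eq_permSubgroup]
      exact ⟨SkewBrace.isRegularStable_permSubgroup _ ha,
        ⟨((SkewBrace.permEquiv _ _).symm.trans e).trans eM⟩⟩
    · rw [SkewBrace.familyN'_eq_permSubgroup]
      exact ⟨SkewBrace.isRegularStable_permSubgroup _ ha,
        ⟨(((SkewBrace.permEquiv _ _).symm.trans (SkewBrace.opDotEquiv _)).trans e).trans eM⟩⟩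
  · have hst := (hiso hs).trans (hiso ht).symm
    simp only [SkewBrace.familyN_eq_permSubgroup, SkewBrace.familyN'_eq_permSubgroup]
    refine ⟨Iff.mpr (SkewBrace.braceEquivalent_permSubgroup_iff _ ha ha) hst,
      Iff.mpr (SkewBrace.braceEquivalent_permSubgroup_iff _ ha ha) hst.op,
      Iff.mpr (Iff.not (SkewBrace.braceEquivalent_permSubgroup_iff _ ha ha)) fun h => ?_⟩
    exact SkewBrace.not_isomorphic_op_charBrace (SkewBrace.powChar_injective hg)
      (((hiso hs).symm.trans h).trans (hiso ht).op)
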